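/- For a partially ordered set $P$ (finite or infinite), let the comparability graph of $P$ be the graph on the elements of $P$ in which two distinct elements are adjacent if and only if they are comparable, and let the dimension $\dim(P)$ be the minimum number $d\ge 1$ of total orders on $P$ whose intersection is the order of $P$. There is a function $\varepsilon:\mathbb{N}\to\mathbb{R}$ with $\varepsilon(\Delta)\to 0$ as $\Delta\to\infty$ such that, for all sufficiently large integers $\Delta$, every poset $P$ whose comparability graph has maximum degree $\Delta$ has finite dimension, and $$\dim(P)\le (360+\varepsilon(\Delta))\,\Delta\,(\log\Delta)\,(2e)^{\sqrt{\log\log\Delta}}\,\log\log\Delta,$$ where $\log$ denotes the natural logarithm. -/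

import Mathlib

open Filter Topology

/-- The comparability graph of a poset: distinct elements `x`, `y` are adjacent iff `x ≤ y` or
`y ≤ x`. -/
def comparabilityGraph (α : Type*) [PartialOrder α] : SimpleGraph α :=
  SimpleGraph.fromRel (fun x y : α => x ≤ y)

/-- The maximum degree of a possibly infinite graph, as an extended natural number. A finite value
is attained by some vertex as soon as there is a vertex. -/
noncomputable def graphMaxDegree {V : Type*} (G : SimpleGraph V) : ℕ∞ :=
  ⨆ v : V, (G.neighborSet v).encard

/-- The order of `α` is the intersection of the `d` total orders `r 0, …, r (d - 1)`. -/
def IsRealizer (α : Type*) [PartialOrder α] {d : ℕ} (r : Fin d → α → α → Prop) : Prop :=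
  (∀ i, IsLinearOrder α (r i)) ∧ ∀ x y : α, x ≤ y ↔ ∀ i, r i x y

/-- The dimension of a poset: the minimum number `d ≥ 1` of total orders whose intersection is the
given order (`⊤` if no finite number suffices). -/
noncomputable def posetDim (α : Type*) [PartialOrder α] : ℕ∞ :=
  ⨅ (d : ℕ) (_ : 1 ≤ d ∧ ∃ r : Fin d → α → α → Prop, IsRealizer α r), (d : ℕ∞)

/-!
A linear extension that puts `y` before `x` is needed for every `x` and every `y` outside the up-set
of `x`. Any order `π` on a set `B` gives one linear extension, in which each element is placed as
early as the first `b ∈ B` above it (`exists_isLinearOrder_of_key`); it puts `y ∈ B` before `x` as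
soon as `y` precedes under `π` all elements of `B` above `x`. So it suffices to find few sets `B`
with few orders each, such that every `y` outside the up-set `U` of `x` precedes `U ∩ B` in one of
the orders of some `B` containing `y`.

Write `L = log Δ`, `M = log log Δ` and `r ≈ √M`. The local lemma splits the poset into `Δ / L`
classes that meet every up-set in at most `d ≈ 8 L` elements, and gives each class `2 L` colourings
with `O(L e^√M / r)` colours, such that in one of them the up-set of `x` meets each colour class in
at most `r` elements (`exists_colourings` in both cases). The sets `B` are these colour classes.

It remains to find `O(r 2^r M)` orders on `B` that put any `y` before any `r` further elements lying
in a common up-set. Colour the poset by bit strings of length `O(L)` that are distinct on each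
up-set, and order `B` lexicographically, with some coordinates reversed. Only the first coordinates
at which `y` differs from each of the `r` elements matter, so the reversals may be taken from a
family that realises all patterns on `r` coordinates (`exists_universal_family`), whose size depends
only logarithmically on the number `O(L)` of coordinates. This is `exists_flipKey_lt`.

The product `(Δ / L) · 2 L · O(L e^√M / r) · O(r 2^r M)` is the asserted bound
(`parameter_product_le`). The local lemma is needed for finite posets only: realizers of a fixed
size pass from finite subposets to the whole poset by compactness
(`exists_isRealizer_of_forall_finset`).
-/

/-! ### The symmetric local lemma, by counting -/

/-- The outcomes that avoid every event `E x` with `x ∈ S`. -/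
def avoiding {Ω A : Type*} [Fintype Ω] [DecidableEq Ω] (E : A → Finset Ω) (S : Finset A) :
    Finset Ω :=
  Finset.univ.filter fun ω => ∀ x ∈ S, ω ∉ E x

section LocalLemma

variable {Ω A : Type*} [Fintype Ω] [DecidableEq Ω]

theorem mem_avoiding {E : A → Finset Ω} {S : Finset A} {ω : Ω} :
    ω ∈ avoiding E S ↔ ∀ x ∈ S, ω ∉ E x := by
  simp [avoiding]

theorem avoiding_anti (E : A → Finset Ω) {S T : Finset A} (h : S ⊆ T) :
    avoiding E T ⊆ avoiding E S := fun _ hω =>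
  mem_avoiding.2 fun x hx => mem_avoiding.1 hω x (h hx)

/-- Passing from the events in `S` to those in `S ∪ S'` loses at most the outcomes that lie in some
event of `S'`. -/
theorem card_avoiding_le [DecidableEq A] (E : A → Finset Ω) {S T : Finset A} (S' : Finset A)
    (h : T ⊆ S ∪ S') :
    (avoiding E S).card ≤ (avoiding E T).card + ∑ x ∈ S', (E x ∩ avoiding E S).card := by
  have : avoiding E S ⊆ avoiding E T ∪ S'.biUnion fun x => E x ∩ avoiding E S := by
    intro ω hω
    by_cases hT : ω ∈ avoiding E T
    · exact Finset.mem_union_left _ hT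
    · rw [mem_avoiding] at hT
      push Not at hT
      obtain ⟨x, hxT, hx⟩ := hT
      refine Finset.mem_union_right _ (Finset.mem_biUnion.2 ⟨x, ?_, Finset.mem_inter.2 ⟨hx, hω⟩⟩)
      rcases Finset.mem_union.1 (h hxT) with hS | hS'
      · exact absurd hx (mem_avoiding.1 hω x hS)
      · exact hS'
  calc (avoiding E S).card
      ≤ (avoiding E T ∪ S'.biUnion fun x => E x ∩ avoiding E S).card := Finset.card_le_card this
    _ ≤ _ := (Finset.card_union_le _ _).trans (Nat.add_le_add_left Finset.card_biUnion_le _)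

/-- The inductive heart of the local lemma: conditioned on avoiding any set of events, each event
has probability at most twice its unconditional bound. -/
theorem card_inter_avoiding_le [DecidableEq A] (E : A → Finset Ω) (Γ : A → Finset A) (D : ℕ)
    (p : ℝ) (hp : 0 ≤ p) (hΓ : ∀ x, (Γ x).card ≤ D)
    (hE : ∀ x (S : Finset A), Disjoint S (Γ x) →
      ((E x ∩ avoiding E S).card : ℝ) ≤ p * (avoiding E S).card)
    (hpD : 4 * p * D ≤ 1) (S : Finset A) (x : A) :
    ((E x ∩ avoiding E S).card : ℝ) ≤ 2 * p * (avoiding E S).card := by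
  induction S using Finset.strongInduction generalizing x with
  | H S ih =>
    by_cases hS : Disjoint S (Γ x)
    · have h1 := hE x S hS
      have h2 : 0 ≤ p * (avoiding E S).card := by positivity
      linarith
    · have hlt : S \ Γ x ⊂ S := by
        refine Finset.ssubset_iff_subset_ne.2 ⟨Finset.sdiff_subset, fun h => hS ?_⟩
        rw [← h]; exact Finset.sdiff_disjoint
      have h1 := hE x (S \ Γ x) Finset.sdiff_disjoint
      have h2 : ((E x ∩ avoiding E S).card : ℝ) ≤ (E x ∩ avoiding E (S \ Γ x)).card := by
        exact_mod_cast Finset.card_le_card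
          (Finset.inter_subset_inter_left (avoiding_anti E Finset.sdiff_subset))
      have h3 : ((avoiding E (S \ Γ x)).card : ℝ) ≤ (avoiding E S).card +
          ∑ y ∈ Γ x, ((E y ∩ avoiding E (S \ Γ x)).card : ℝ) := by
        exact_mod_cast card_avoiding_le E (Γ x)
          (show S ⊆ S \ Γ x ∪ Γ x by simp)
      have h4 : ∑ y ∈ Γ x, ((E y ∩ avoiding E (S \ Γ x)).card : ℝ) ≤
          D * (2 * p * (avoiding E (S \ Γ x)).card) := by
        calc _ ≤ ∑ y ∈ Γ x, 2 * p * ((avoiding E (S \ Γ x)).card : ℝ) :=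
              Finset.sum_le_sum fun y _ => ih _ hlt y
          _ = (Γ x).card * (2 * p * (avoiding E (S \ Γ x)).card) := by simp
          _ ≤ _ := by
              have : ((Γ x).card : ℝ) ≤ D := by exact_mod_cast hΓ x
              gcongr
      set a : ℝ := ((avoiding E (S \ Γ x)).card : ℝ) with ha0
      have ha : 0 ≤ a := Nat.cast_nonneg _
      have h5 : D * (2 * p * a) ≤ a / 2 := by nlinarith
      have h6 : a ≤ 2 * (avoiding E S).card := by linarith
      have h7 : p * a ≤ p * (2 * (avoiding E S).card) := by gcongr
      linarith

/-- The symmetric Lovász local lemma on a finite uniform probability space. -/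
theorem exists_forall_notMem_of_local [Nonempty Ω] [Fintype A] [DecidableEq A] (E : A → Finset Ω)
    (Γ : A → Finset A) (D : ℕ) (p : ℝ) (hp : 0 ≤ p) (hD : 0 < D) (hΓ : ∀ x, (Γ x).card ≤ D)
    (hE : ∀ x (S : Finset A), Disjoint S (Γ x) →
      ((E x ∩ avoiding E S).card : ℝ) ≤ p * (avoiding E S).card)
    (hpD : 4 * p * D ≤ 1) : ∃ ω, ∀ x, ω ∉ E x := by
  have hD1 : (1 : ℝ) ≤ D := by exact_mod_cast hD
  have hp1 : 2 * p ≤ 1 / 2 := by nlinarith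
  have key : ∀ S : Finset A, 0 < (avoiding E S).card := by
    intro S
    induction S using Finset.induction_on with
    | empty => simp [avoiding, Fintype.card_pos]
    | insert x S _ ih =>
      have h1 := card_inter_avoiding_le E Γ D p hp hΓ hE hpD S x
      have h2 : ((avoiding E S).card : ℝ) ≤ (avoiding E (insert x S)).card +
          (E x ∩ avoiding E S).card := by
        have := card_avoiding_le E (S := S) (T := insert x S) {x}
          (by intro y; simp only [Finset.mem_insert, Finset.mem_union, Finset.mem_singleton]; tauto)
        rw [Finset.sum_singleton] at this
        exact_mod_cast this
      have h3 : (0 : ℝ) < (avoiding E S).card := by exact_mod_cast ih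
      have h4 : (0 : ℝ) < (avoiding E (insert x S)).card := by nlinarith
      exact_mod_cast h4
  obtain ⟨ω, hω⟩ := Finset.card_pos.1 (key Finset.univ)
  exact ⟨ω, fun x => mem_avoiding.1 hω x (Finset.mem_univ x)⟩

end LocalLemma

/-- Events on a finite product space that depend on complementary sets of coordinates are
(sub)independent. -/
theorem card_inter_mul_card_le {B C : Type*} [Fintype B] [DecidableEq B] [Fintype C]
    [DecidableEq C] (T : Finset B) (E F : Finset (B → C))
    (hE : ∀ u v : B → C, (∀ b ∈ T, u b = v b) → u ∈ E → v ∈ E)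
    (hF : ∀ u v : B → C, (∀ b ∉ T, u b = v b) → u ∈ F → v ∈ F) :
    (E ∩ F).card * Fintype.card (B → C) ≤ E.card * F.card := by
  rw [← Finset.card_univ, ← Finset.card_product, ← Finset.card_product]
  -- The map exchanges the coordinates outside `T` of two outcomes; it is an involution.
  refine Finset.card_le_card_of_injOn (fun w => (T.piecewise w.1 w.2, T.piecewise w.2 w.1)) ?_ ?_
  · rintro ⟨u, v⟩ h
    simp only [Finset.coe_product, Set.mem_prod, Finset.mem_coe, Finset.mem_inter] at h
    simp only [Finset.coe_product, Set.mem_prod, Finset.mem_coe]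
    exact ⟨hE u _ (fun b hb => by simp [hb]) h.1.1, hF u _ (fun b hb => by simp [hb]) h.1.2⟩
  · rintro ⟨u, v⟩ _ ⟨u', v'⟩ _ h
    simp only [Prod.mk.injEq] at h ⊢
    constructor <;> funext b <;> by_cases hb : b ∈ T
    · simpa [hb] using congrFun h.1 b
    · simpa [hb] using congrFun h.2 b
    · simpa [hb] using congrFun h.2 b
    · simpa [hb] using congrFun h.1 b

/-- The local lemma for events `E x` that depend only on the coordinates in `N x`, where each `N x`
has at most `d` elements and each coordinate lies in at most `D` of the sets `N x`. -/
theorem exists_forall_notMem_of_coordinates {A B C : Type*} [Fintype A] [DecidableEq A] [Fintype B]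
    [DecidableEq B] [Fintype C] [DecidableEq C] [Nonempty C] (N : A → Finset B) (d D : ℕ)
    (hd : 0 < d) (hD : 0 < D) (hN : ∀ x, (N x).card ≤ d)
    (hN' : ∀ b, (Finset.univ.filter fun x => b ∈ N x).card ≤ D) (E : A → Finset (B → C))
    (hE : ∀ x (u v : B → C), (∀ b ∈ N x, u b = v b) → u ∈ E x → v ∈ E x) (p : ℝ) (hp : 0 ≤ p)
    (hcard : ∀ x, ((E x).card : ℝ) ≤ p * Fintype.card (B → C))
    (hpD : 4 * p * (d * D : ℕ) ≤ 1) : ∃ ω, ∀ x, ω ∉ E x := by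
  refine exists_forall_notMem_of_local E
    (fun x => (N x).biUnion fun b => Finset.univ.filter fun y => b ∈ N y) (d * D) p hp
    (Nat.mul_pos hd hD) (fun x => ?_) (fun x S hS => ?_) hpD
  · refine (Finset.card_biUnion_le_card_mul _ _ D fun b _ => hN' b).trans ?_
    exact Nat.mul_le_mul_right _ (hN x)
  · have h1 := card_inter_mul_card_le (N x) (E x) (avoiding E S) (hE x) (by
      intro u v huv hu
      rw [mem_avoiding] at hu ⊢
      intro y hy hv
      refine hu y hy (hE y v u (fun b hb => ?_) hv)
      refine (huv b fun hbx => ?_).symm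
      refine Finset.disjoint_left.1 hS hy (Finset.mem_biUnion.2 ⟨b, hbx, ?_⟩)
      simpa using hb)
    have hpos : (0 : ℝ) < Fintype.card (B → C) := by exact_mod_cast Fintype.card_pos
    have h2 : ((E x ∩ avoiding E S).card : ℝ) * Fintype.card (B → C) ≤
        (E x).card * (avoiding E S).card := by exact_mod_cast h1
    have h3 : ((E x).card : ℝ) * (avoiding E S).card ≤
        p * Fintype.card (B → C) * (avoiding E S).card := by
      gcongr; exact hcard x
    refine le_of_mul_le_mul_right ?_ hpos
    linarith

/-! ### Colourings in which few elements of each set share a colour -/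

theorem card_filter_eq_const_mul {B C : Type*} [Fintype B] [DecidableEq B] [Fintype C]
    [DecidableEq C] (T : Finset B) (g : B → C) :
    (Finset.univ.filter fun f : B → C => ∀ b ∈ T, f b = g b).card * Fintype.card C ^ T.card =
      Fintype.card C ^ Fintype.card B := by
  have h1 : (Finset.univ.filter fun f : B → C => ∀ b ∈ T, f b = g b) =
      Fintype.piFinset fun b => if b ∈ T then {g b} else Finset.univ := by
    ext f
    simp only [Finset.mem_filter, Finset.mem_univ, true_and, Fintype.mem_piFinset]
    refine forall_congr' fun b => ?_
    by_cases hb : b ∈ T <;> simp [hb]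
  rw [h1, Fintype.card_piFinset]
  have h2 : ∀ b, (if b ∈ T then ({g b} : Finset C) else Finset.univ).card =
      if b ∈ T then 1 else Fintype.card C := by
    intro b; split_ifs <;> simp
  simp only [h2]
  rw [Finset.prod_ite, Finset.prod_const_one, one_mul, Finset.prod_const, ← pow_add]
  congr 1
  rw [show (Finset.univ.filter fun b => b ∉ T) = Tᶜ by ext; simp]
  rw [Finset.card_compl]
  have := Finset.card_le_univ T
  omega

/-- The colourings `f` under which some colour is used more than `r` times on `T`. -/
def crowded {B : Type*} [Fintype B] [DecidableEq B] (l r : ℕ) (T : Finset B) :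
    Finset (B → Fin l) :=
  Finset.univ.filter fun f => ∃ a, r < (T.filter fun b => f b = a).card

theorem card_crowded_mul_le {B : Type*} [Fintype B] [DecidableEq B] (l r : ℕ) (hl : 0 < l)
    (T : Finset B) :
    (crowded l r T).card * l ^ r ≤ T.card.choose (r + 1) * l ^ Fintype.card B := by
  have hsub : crowded l r T ⊆ ((T.powersetCard (r + 1)) ×ˢ (Finset.univ : Finset (Fin l))).biUnion
      fun w => Finset.univ.filter fun f : B → Fin l => ∀ b ∈ w.1, f b = w.2 := by
    intro f hf
    simp only [crowded, Finset.mem_filter, Finset.mem_univ, true_and] at hf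
    obtain ⟨a, ha⟩ := hf
    obtain ⟨S, hS, hcard⟩ := Finset.exists_subset_card_eq (Nat.succ_le_of_lt ha)
    simp only [Finset.mem_biUnion, Finset.mem_product, Finset.mem_powersetCard, Finset.mem_univ,
      and_true, Finset.mem_filter, true_and, Prod.exists]
    exact ⟨S, a, ⟨hS.trans (Finset.filter_subset _ _), hcard⟩,
      fun b hb => (Finset.mem_filter.1 (hS hb)).2⟩
  have h1 : (crowded l r T).card * l ^ (r + 1) ≤
      T.card.choose (r + 1) * l * l ^ Fintype.card B := by
    calc (crowded l r T).card * l ^ (r + 1)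
        ≤ (∑ w ∈ (T.powersetCard (r + 1)) ×ˢ (Finset.univ : Finset (Fin l)),
          (Finset.univ.filter fun f : B → Fin l => ∀ b ∈ w.1, f b = w.2).card) * l ^ (r + 1) :=
          Nat.mul_le_mul_right _ ((Finset.card_le_card hsub).trans Finset.card_biUnion_le)
      _ = ∑ w ∈ (T.powersetCard (r + 1)) ×ˢ (Finset.univ : Finset (Fin l)),
            l ^ Fintype.card B := by
          rw [Finset.sum_mul]
          refine Finset.sum_congr rfl fun w hw => ?_
          have hw' := (Finset.mem_powersetCard.1 (Finset.mem_product.1 hw).1).2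
          have := card_filter_eq_const_mul w.1 (fun _ : B => w.2)
          rwa [hw', Fintype.card_fin] at this
      _ = _ := by simp
  refine Nat.le_of_mul_le_mul_right (c := l) ?_ hl
  calc _ = (crowded l r T).card * l ^ (r + 1) := by ring
    _ ≤ _ := h1
    _ = _ := by ring

/-- If `4 d D (d choose (r+1))^t ≤ l^(r t)`, then there are `t` colourings with `l` colours such
that every set `N x` is uncrowded (at most `r` elements of each colour) in at least one of them.
Taking several colourings makes the failure probability a `t`-th power, so that `l` need not grow with
`D`. -/
theorem exists_colourings {A B : Type*} [Finite A] [Finite B] [DecidableEq B]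
    (N : A → Finset B) (d D r t l : ℕ) (hd : 0 < d) (hD : 0 < D) (hl : 0 < l)
    (hN : ∀ x, (N x).card ≤ d) (hN' : ∀ b, {x | b ∈ N x}.ncard ≤ D)
    (hl' : 4 * (d * D) * d.choose (r + 1) ^ t ≤ l ^ (r * t)) :
    ∃ c : Fin t → B → Fin l, ∀ x, ∃ i, ∀ a, ((N x).filter fun b => c i b = a).card ≤ r := by
  classical
  have := Fintype.ofFinite A
  have := Fintype.ofFinite B
  have : Nonempty (Fin l) := ⟨⟨0, hl⟩⟩
  let E : A → Finset (B → Fin t → Fin l) := fun x =>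
    Finset.univ.filter fun f => ∀ i, (fun b => f b i) ∈ crowded l r (N x)
  have hcardE : ∀ x, (E x).card = (crowded l r (N x)).card ^ t := by
    intro x
    rw [← Fintype.card_piFinset_const (crowded l r (N x)) t]
    refine Finset.card_bij (fun f _ i b => f b i) ?_ ?_ ?_
    · intro f hf
      simpa [E, Fintype.mem_piFinset] using hf
    · intro f _ g _ h
      funext b i
      exact congrFun (congrFun h i) b
    · intro g hg
      exact ⟨fun b i => g i b, by simpa [E, Fintype.mem_piFinset] using hg, rfl⟩
  have hl0 : (0 : ℝ) < l := by exact_mod_cast hl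
  obtain ⟨f, hf⟩ := exists_forall_notMem_of_coordinates N d D hd hD hN
    (fun b => by rw [← Set.ncard_coe_finset]; simpa using hN' b) E
    (fun x u v huv hu => by
      simp only [E, crowded, Finset.mem_filter, Finset.mem_univ, true_and] at hu ⊢
      intro i
      obtain ⟨a, ha⟩ := hu i
      refine ⟨a, ha.trans_eq (congrArg _ (Finset.filter_congr fun b hb => ?_))⟩
      rw [huv b hb])
    (((d.choose (r + 1) : ℝ) / l ^ r) ^ t) (by positivity)
    (fun x => by
      have h1 : (crowded l r (N x)).card * l ^ r ≤ d.choose (r + 1) * l ^ Fintype.card B :=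
        (card_crowded_mul_le l r hl (N x)).trans
          (Nat.mul_le_mul_right _ (Nat.choose_le_choose _ (hN x)))
      have h2 : ((crowded l r (N x)).card : ℝ) ≤
          (d.choose (r + 1) : ℝ) / l ^ r * l ^ Fintype.card B := by
        rw [div_mul_eq_mul_div, le_div_iff₀ (by positivity)]
        exact_mod_cast h1
      have h3 : (Fintype.card (B → Fin t → Fin l) : ℝ) = ((l : ℝ) ^ Fintype.card B) ^ t := by
        simp [← pow_mul, mul_comm]
      rw [hcardE, h3, ← mul_pow]
      push_cast
      gcongr)
    (by
      rw [div_pow, ← pow_mul, mul_div_assoc', div_mul_eq_mul_div, div_le_one (by positivity)]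
      calc _ = ((4 * (d * D) * d.choose (r + 1) ^ t : ℕ) : ℝ) := by push_cast; ring
        _ ≤ _ := by exact_mod_cast hl')
  refine ⟨fun i b => f b i, fun x => ?_⟩
  have := hf x
  simp only [E, crowded, Finset.mem_filter, Finset.mem_univ, true_and] at this
  push Not at this
  exact this

/-! ### Universal families of flips -/

/-- If `p` is large enough, some `p` zero-one vectors indexed by `I` realise every pattern on every
set of at most `r` coordinates. -/
theorem exists_universal_family {I : Type*} [Fintype I] [DecidableEq I] (r p : ℕ)
    (hr : r ≤ Fintype.card I)
    (hp : (Fintype.card I).choose r * 2 ^ r * (2 ^ r - 1) ^ p < 2 ^ (r * p)) :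
    ∃ F : Fin p → I → Bool, ∀ T : Finset I, T.card ≤ r → ∀ g : I → Bool,
      ∃ k, ∀ c ∈ T, F k c = g c := by
  classical
  let W := ((Finset.univ : Finset I).powersetCard r).sigma fun T => T.powerset
  -- the vectors that miss the pattern `G` on `T`
  let M : (Σ _ : Finset I, Finset I) → Finset (I → Bool) := fun w =>
    (Finset.univ.filter fun f => ∀ c ∈ w.1, f c = decide (c ∈ w.2))ᶜ
  have hM : ∀ w ∈ W, (M w).card * 2 ^ r = 2 ^ Fintype.card I * (2 ^ r - 1) := by
    intro w hw
    have hw1 : w.1.card = r := by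
      have := (Finset.mem_sigma.1 hw).1
      exact (Finset.mem_powersetCard.1 this).2
    have h := card_filter_eq_const_mul (C := Bool) w.1 (fun c => decide (c ∈ w.2))
    rw [hw1, Fintype.card_bool] at h
    simp only [M]
    rw [Finset.card_compl, Nat.sub_mul, h, Fintype.card_fun, Fintype.card_bool, Nat.mul_sub,
      mul_one]
  have hWcard : W.card = (Fintype.card I).choose r * 2 ^ r := by
    rw [Finset.card_sigma, Finset.sum_congr rfl (g := fun _ => 2 ^ r)]
    · simp
    · intro T hT
      rw [Finset.card_powerset, (Finset.mem_powersetCard.1 hT).2]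
  have hbad : (W.biUnion fun w => Fintype.piFinset fun _ : Fin p => M w).card <
      Fintype.card (Fin p → I → Bool) := by
    refine lt_of_mul_lt_mul_right (a := 2 ^ (r * p)) ?_ (Nat.zero_le _)
    calc _ ≤ (∑ w ∈ W, (M w).card ^ p) * 2 ^ (r * p) := by
          refine Nat.mul_le_mul_right _ (Finset.card_biUnion_le.trans_eq ?_)
          simp [Fintype.card_piFinset]
      _ = ∑ w ∈ W, (2 ^ Fintype.card I * (2 ^ r - 1)) ^ p := by
          rw [Finset.sum_mul]
          refine Finset.sum_congr rfl fun w hw => ?_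
          rw [pow_mul, ← mul_pow, hM w hw]
      _ = (2 ^ Fintype.card I) ^ p *
            ((Fintype.card I).choose r * 2 ^ r * (2 ^ r - 1) ^ p) := by
          rw [Finset.sum_const, hWcard, smul_eq_mul, mul_pow]; ring
      _ < (2 ^ Fintype.card I) ^ p * 2 ^ (r * p) := by
          exact Nat.mul_lt_mul_of_pos_left hp (by positivity)
      _ = _ := by simp
  obtain ⟨F, hF⟩ : ∃ F : Fin p → I → Bool,
      F ∉ W.biUnion fun w => Fintype.piFinset fun _ : Fin p => M w := by
    by_contra! h
    refine hbad.ne ?_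
    rw [← Finset.card_univ]
    congr 1
    exact Finset.eq_univ_iff_forall.2 h
  refine ⟨F, fun T hT g => ?_⟩
  obtain ⟨T', hTT', -, hT'⟩ := Finset.exists_subsuperset_card_eq (Finset.subset_univ T) hT
    (by rwa [Finset.card_univ])
  have hw : (⟨T', T'.filter fun c => g c = true⟩ : Σ _ : Finset I, Finset I) ∈ W :=
    Finset.mem_sigma.2 ⟨Finset.mem_powersetCard.2 ⟨Finset.subset_univ _, hT'⟩,
      Finset.mem_powerset.2 (Finset.filter_subset _ _)⟩
  have h1 : ¬ ∀ k, F k ∈ M ⟨T', T'.filter fun c => g c = true⟩ := fun h =>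
    hF (Finset.mem_biUnion.2 ⟨_, hw, Fintype.mem_piFinset.2 h⟩)
  push Not at h1
  obtain ⟨k, hk⟩ := h1
  simp only [M, Finset.mem_compl, Finset.mem_filter, Finset.mem_univ, true_and, not_not] at hk
  refine ⟨k, fun c hc => ?_⟩
  rw [hk c (hTT' hc)]
  simp [hTT' hc]

/-! ### Flipped lexicographic orders -/

/-- The position of `b` in the lexicographic order of the colours `χ b`, in which coordinate `c` is
reversed if `F (some c)` holds; equal colours are ordered by `ρ`, reversed unless `F none`. -/
def flipKey {P : Type*} {h : ℕ} (χ : P → Fin h → Bool) (ρ : P → ℤ) (F : Option (Fin h) → Bool)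
    (b : P) : Lex (Fin h → Bool) ×ₗ ℤ :=
  toLex (toLex fun c => xor (χ b c) (F (some c)), if F none then ρ b else -ρ b)

/-- If no two elements of `S` have the same colour, then one of the orders given by a universal
family puts `y` before all of `S`: only the first coordinate at which `y` differs from each `s ∈ S`
matters, and these are at most `r` coordinates. -/
theorem exists_flipKey_lt {P : Type*} {h p r : ℕ} (χ : P → Fin h → Bool)
    (ρ : P → ℤ) (hρ : Function.Injective ρ) (F : Fin p → Option (Fin h) → Bool)
    (hF : ∀ T : Finset (Option (Fin h)), T.card ≤ r → ∀ g : Option (Fin h) → Bool,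
      ∃ k, ∀ c ∈ T, F k c = g c)
    (S : Finset P) (hS : S.card ≤ r) (hχ : Set.InjOn χ S) (y : P) (hy : y ∉ S) :
    ∃ k, ∀ s ∈ S, flipKey χ ρ (F k) y < flipKey χ ρ (F k) s := by
  classical
  have hfirst : ∀ s : P, ∃ c : Option (Fin h), (c = none ∧ χ y = χ s) ∨
      ∃ i, c = some i ∧ (∀ j < i, χ y j = χ s j) ∧ χ y i ≠ χ s i := by
    intro s
    by_cases hs : χ y = χ s
    · exact ⟨none, Or.inl ⟨rfl, hs⟩⟩
    · have hne : (Finset.univ.filter fun i => χ y i ≠ χ s i).Nonempty := by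
        obtain ⟨i, hi⟩ := Function.ne_iff.1 hs
        exact ⟨i, by simpa using hi⟩
      refine ⟨some (Finset.min' _ hne), Or.inr ⟨_, rfl, fun j hj => ?_, ?_⟩⟩
      · by_contra hcon
        exact absurd (Finset.min'_le _ j (by simpa using hcon)) (not_le.2 hj)
      · simpa using Finset.min'_mem _ hne
  choose c hc using hfirst
  let g : Option (Fin h) → Bool := fun o =>
    o.elim (decide (∃ s ∈ S, χ y = χ s ∧ ρ y < ρ s)) (χ y)
  obtain ⟨k, hk⟩ := hF (S.image c) (Finset.card_image_le.trans hS) g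
  refine ⟨k, fun s hs => ?_⟩
  have hks := hk (c s) (Finset.mem_image_of_mem c hs)
  rw [flipKey, flipKey, Prod.Lex.toLex_lt_toLex]
  rcases hc s with ⟨hcs, heq⟩ | ⟨i, hcs, hlt, hne⟩
  · refine Or.inr ⟨by simp only [heq], ?_⟩
    have hys : ρ y ≠ ρ s := fun he => hy (hρ he ▸ hs)
    rw [hcs] at hks
    simp only [hks, g, Option.elim]
    by_cases hlt : ρ y < ρ s
    · rw [if_pos, if_pos]
      · exact hlt
      · exact decide_eq_true ⟨s, hs, heq, hlt⟩
      · exact decide_eq_true ⟨s, hs, heq, hlt⟩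
    · have hno : ¬ ∃ s ∈ S, χ y = χ s ∧ ρ y < ρ s := by
        rintro ⟨s', hs', heq', hlt'⟩
        exact hlt (hχ hs' hs (heq'.symm.trans heq) ▸ hlt')
      simp only [hno, decide_false, Bool.false_eq_true, if_false]
      omega
  · left
    rw [hcs] at hks
    refine ⟨i, fun j hj => ?_, ?_⟩
    · simp only [Pi.toLex_apply] at *
      rw [hlt j hj]
    · simp only [Pi.toLex_apply, hks, g, Option.elim]
      revert hne
      cases χ y i <;> cases χ s i <;> simp

/-! ### Linear extensions and realizers -/

/-- The lexicographic order given by a monotone map followed by any linear extension is again a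
linear extension. -/
theorem exists_isLinearOrder_of_monotone {P K : Type*} [PartialOrder P] [LinearOrder K] (f : P → K)
    (hf : Monotone f) : ∃ r : P → P → Prop, IsLinearOrder P r ∧ (∀ x y, x ≤ y → r x y) ∧
      ∀ x y, f y < f x → ¬ r x y := by
  let φ : P → K ×ₗ LinearExtension P := fun x => toLex (f x, toLinearExtension x)
  have hφ : Function.Injective φ := fun x y hxy =>
    congrArg Prod.snd (toLex.injective hxy)
  refine ⟨fun x y => φ x ≤ φ y, ?_, fun x y hxy => ?_, fun x y hlt h => ?_⟩
  · exact {
      refl := fun x => le_refl _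
      trans := fun x y z h1 h2 => le_trans h1 h2
      antisymm := fun x y h1 h2 => hφ (le_antisymm h1 h2)
      total := fun x y => le_total _ _ }
  · exact Prod.Lex.toLex_mono ⟨hf hxy, toLinearExtension.monotone hxy⟩
  · rcases Prod.Lex.toLex_le_toLex.1 h with h | h
    · exact absurd h (not_lt.2 hlt.le)
    · exact hlt.ne' h.1

/-- The order in which elements below `b ∈ B` are placed as early as `b`, for a given key on `B`. If
the key of `y ∈ B` is smaller than that of all `b ∈ B` above `x`, then `y` comes before `x`. -/
theorem exists_isLinearOrder_of_key {P K : Type*} [PartialOrder P] [LinearOrder K] (B : Finset P)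
    (key : P → K) : ∃ r : P → P → Prop, IsLinearOrder P r ∧ (∀ x y, x ≤ y → r x y) ∧
      ∀ x, ∀ y ∈ B, (∀ b ∈ B, x ≤ b → key y < key b) → ¬ r x y := by
  classical
  obtain ⟨r, h1, h2, h3⟩ := exists_isLinearOrder_of_monotone
    (fun u : P => (B.filter (u ≤ ·)).inf fun b => (key b : WithTop K)) (by
      intro u v huv
      refine Finset.inf_mono fun b hb => ?_
      rw [Finset.mem_filter] at hb ⊢
      exact ⟨hb.1, huv.trans hb.2⟩)
  refine ⟨r, h1, h2, fun x y hy hxy => h3 x y ?_⟩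
  have h4 : (B.filter (y ≤ ·)).inf (fun b => (key b : WithTop K)) ≤ key y :=
    Finset.inf_le (f := fun b => (key b : WithTop K)) (Finset.mem_filter.2 ⟨hy, le_refl y⟩)
  refine h4.trans_lt ((Finset.lt_inf_iff (WithTop.coe_lt_top _)).2 fun b hb => ?_)
  rw [Finset.mem_filter] at hb
  exact WithTop.coe_lt_coe.2 (hxy b hb.1 hb.2)

/-- A realizer from linear extensions indexed by an arbitrary type with `N` elements. -/
theorem exists_isRealizer_of_fintype {P I : Type*} [PartialOrder P] [Fintype I] {N : ℕ}
    (hI : Fintype.card I = N) (R : I → P → P → Prop) (h1 : ∀ w, IsLinearOrder P (R w))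
    (h2 : ∀ w x y, x ≤ y → R w x y) (h3 : ∀ x y, ¬ x ≤ y → ∃ w, ¬ R w x y) :
    ∃ r : Fin N → P → P → Prop, IsRealizer P r := by
  let e := (Fintype.equivFinOfCardEq hI).symm
  refine ⟨fun k => R (e k), fun k => h1 _, fun x y => ⟨fun hxy k => h2 _ x y hxy, fun h => ?_⟩⟩
  by_contra hxy
  obtain ⟨w, hw⟩ := h3 x y hxy
  refine hw ?_
  simpa using h (e.symm w)

/-- A colouring by bit strings that is injective on each of the sets `U x`. -/
theorem exists_injOn_colouring {A B : Type*} [Finite A] [Finite B] [DecidableEq B]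
    (U : A → Finset B) (n h : ℕ) (hn : 0 < n) (hU : ∀ x, (U x).card ≤ n)
    (hU' : ∀ b, {x | b ∈ U x}.ncard ≤ n) (h3 : 4 * (n * n) * n.choose 2 ≤ 2 ^ h) :
    ∃ χ : B → Fin h → Bool, ∀ x, Set.InjOn χ (U x) := by
  obtain ⟨q, hq⟩ := exists_colourings U n n 1 1 (2 ^ h) hn hn (by positivity) hU hU'
    (by simpa using h3)
  let e : Fin (2 ^ h) ≃ (Fin h → Bool) := Fintype.equivOfCardEq (by simp)
  refine ⟨fun b => e (q 0 b), fun x b hb b' hb' hbb' => ?_⟩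
  obtain ⟨i, hi⟩ := hq x
  rw [Subsingleton.elim i 0] at hi
  have hqq : q 0 b = q 0 b' := e.injective hbb'
  exact Finset.card_le_one.1 (hi (q 0 b)) b (Finset.mem_filter.2 ⟨hb, rfl⟩) b'
    (Finset.mem_filter.2 ⟨hb', hqq.symm⟩)

/-- The dimension bound for finite posets, in terms of free parameters: `n` bounds the size of
up-sets and down-sets, the poset is split into `m` classes that meet each up-set in at most `d`
elements, each class gets `t` colourings with `l` colours, and each colour class gets `p` flipped
lexicographic orders on colours in `{0,1}^h`. -/
theorem exists_isRealizer_of_finite {P : Type*} [PartialOrder P] [Finite P]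
    (n m d r t l h p : ℕ) (hn : 0 < n) (hm : 0 < m) (hd : 0 < d) (hl : 0 < l)
    (hup : ∀ x : P, (Set.Ici x).ncard ≤ n) (hdown : ∀ x : P, (Set.Iic x).ncard ≤ n)
    (h1 : 4 * (n * n) * n.choose (d + 1) ≤ m ^ d)
    (h2 : 4 * (d * n) * d.choose (r + 1) ^ t ≤ l ^ (r * t))
    (h3 : 4 * (n * n) * n.choose 2 ≤ 2 ^ h) (hr : r ≤ h + 1)
    (h4 : (h + 1).choose r * 2 ^ r * (2 ^ r - 1) ^ p < 2 ^ (r * p)) :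
    ∃ ρ : Fin (m * t * l * p) → P → P → Prop, IsRealizer P ρ := by
  classical
  have := Fintype.ofFinite P
  obtain ⟨U, hmem⟩ : ∃ U : P → Finset P, ∀ x b, b ∈ U x ↔ x ≤ b :=
    ⟨fun x => Finset.univ.filter (x ≤ ·), by simp⟩
  have hU : ∀ x, (U x).card ≤ n := fun x => by
    rw [← Set.ncard_coe_finset, show (U x : Set P) = Set.Ici x by ext b; simp [hmem]]
    exact hup x
  have hU' : ∀ b, {x | b ∈ U x}.ncard ≤ n := fun b => by
    simpa [hmem, Set.Iic] using hdown b
  obtain ⟨c₀, hc₀⟩ : ∃ c₀ : P → Fin m, ∀ x j, ((U x).filter fun b => c₀ b = j).card ≤ d := by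
    obtain ⟨c, hc⟩ := exists_colourings U n n d 1 m hn hn hm hU hU' (by simpa using h1)
    refine ⟨c 0, fun x => ?_⟩
    obtain ⟨i, hi⟩ := hc x
    rwa [Subsingleton.elim i 0] at hi
  obtain ⟨χ, hχ⟩ := exists_injOn_colouring U n h hn hU hU' h3
  have hc : ∀ j : Fin m, ∃ c : Fin t → P → Fin l, ∀ x, ∃ i, ∀ a,
      (((U x).filter fun b => c₀ b = j).filter fun b => c i b = a).card ≤ r := by
    intro j
    refine exists_colourings (fun x => (U x).filter fun b => c₀ b = j) d n r t l hd hn hl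
      (fun x => hc₀ x j) (fun b => le_trans ?_ (hU' b)) h2
    refine Set.ncard_le_ncard (fun x hx => ?_) (Set.toFinite _)
    exact (Finset.mem_filter.1 hx).1
  choose c hc using hc
  obtain ⟨F, hF⟩ := exists_universal_family (I := Option (Fin h)) r p (by simpa using hr)
    (by simpa using h4)
  obtain ⟨ρ, hρ⟩ : ∃ ρ : P → ℤ, Function.Injective ρ :=
    ⟨fun b => ((Fintype.equivFin P b : ℕ) : ℤ), fun a b hab => by
      simpa [Fin.val_inj] using hab⟩
  choose R hR1 hR2 hR3 using fun w : ((Fin m × Fin t) × Fin l) × Fin p =>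
    exists_isLinearOrder_of_key
      (Finset.univ.filter fun b => c₀ b = w.1.1.1 ∧ c w.1.1.1 w.1.1.2 b = w.1.2)
      (flipKey χ ρ (F w.2))
  refine exists_isRealizer_of_fintype (by simp) R hR1 hR2 fun x y hxy => ?_
  obtain ⟨i, hi⟩ := hc (c₀ y) x
  obtain ⟨k, hk⟩ := exists_flipKey_lt χ ρ hρ F hF _ (hi (c (c₀ y) i y))
    ((hχ x).mono fun b hb => (Finset.mem_filter.1 (Finset.mem_filter.1 hb).1).1) y
    (by simp [hmem, hxy])
  refine ⟨(((c₀ y, i), c (c₀ y) i y), k), hR3 _ x y (by simp) fun b hb hxb => hk b ?_⟩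
  simp only [Finset.mem_filter, Finset.mem_univ, true_and] at hb ⊢
  exact ⟨⟨(hmem x b).2 hxb, hb.1⟩, hb.2⟩

/-- Compactness: a poset has a realizer of size `d` if each of its finite subposets does. -/
theorem exists_isRealizer_of_forall_finset {P : Type*} [PartialOrder P] {d : ℕ}
    (hfin : ∀ T : Finset P, ∃ r : Fin d → T → T → Prop, IsRealizer T r) :
    ∃ r : Fin d → P → P → Prop, IsRealizer P r := by
  classical
  choose r hr using hfin
  let V : Finset (P × P) → Finset P := fun S => S.image Prod.fst ∪ S.image Prod.snd
  obtain ⟨χ, hχ⟩ := Finset.rado_selection (α := P × P) (β := fun _ => Fin d → Prop)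
    fun S w i => ∃ (h1 : w.1 ∈ V S) (h2 : w.2 ∈ V S), r (V S) i ⟨w.1, h1⟩ ⟨w.2, h2⟩
  -- On a finite set of elements, `χ` agrees with a realizer of a finite subposet containing it.
  have key : ∀ X : Finset P, ∃ (T : Finset P) (hT : X ⊆ T), ∀ x (hx : x ∈ X) y (hy : y ∈ X) i,
      χ (x, y) i ↔ r T i ⟨x, hT hx⟩ ⟨y, hT hy⟩ := by
    intro X
    obtain ⟨S, hS, hS'⟩ := hχ (X ×ˢ X)
    have hXS : X ⊆ V S := fun x hx => Finset.mem_union_left _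
      (Finset.mem_image.2 ⟨(x, x), hS (Finset.mem_product.2 ⟨hx, hx⟩), rfl⟩)
    refine ⟨V S, hXS, fun x hx y hy i => ?_⟩
    rw [hS' (x, y) (Finset.mem_product.2 ⟨hx, hy⟩)]
    exact ⟨fun ⟨_, _, h⟩ => h, fun h => ⟨_, _, h⟩⟩
  refine ⟨fun i x y => χ (x, y) i, fun i => ?_, fun x y => ?_⟩
  · refine { refl := fun x => ?_, trans := fun x y z h1 h2 => ?_, antisymm := fun x y h1 h2 => ?_,
             total := fun x y => ?_ }
    · obtain ⟨T, hT, h⟩ := key {x}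
      have := (hr T).1 i
      rw [h x (by simp) x (by simp)]
      exact refl_of (r T i) _
    · obtain ⟨T, hT, h⟩ := key {x, y, z}
      have := (hr T).1 i
      rw [h x (by simp) y (by simp)] at h1
      rw [h y (by simp) z (by simp)] at h2
      rw [h x (by simp) z (by simp)]
      exact trans_of (r T i) h1 h2
    · obtain ⟨T, hT, h⟩ := key {x, y}
      have := (hr T).1 i
      rw [h x (by simp) y (by simp)] at h1
      rw [h y (by simp) x (by simp)] at h2
      exact congrArg Subtype.val (antisymm_of (r T i) h1 h2)
    · obtain ⟨T, hT, h⟩ := key {x, y}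
      have := (hr T).1 i
      change χ (x, y) i ∨ χ (y, x) i
      rw [h x (by simp) y (by simp), h y (by simp) x (by simp)]
      exact total_of (r T i) _ _
  · obtain ⟨T, hT, h⟩ := key {x, y}
    rw [forall_congr' (h x (by simp) y (by simp))]
    exact (hr T).2 ⟨x, hT (by simp)⟩ ⟨y, hT (by simp)⟩

/-! ### Comparability graphs of bounded degree -/

theorem encard_comparabilityGraph_neighborSet {P : Type*} [PartialOrder P] {Δ : ℕ}
    (h : graphMaxDegree (comparabilityGraph P) ≤ Δ) (x : P) :
    ((comparabilityGraph P).neighborSet x).encard ≤ Δ :=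
  (le_iSup (fun v => ((comparabilityGraph P).neighborSet v).encard) x).trans h

theorem encard_Ici_le {P : Type*} [PartialOrder P] {Δ : ℕ}
    (h : graphMaxDegree (comparabilityGraph P) ≤ Δ) (x : P) :
    (Set.Ici x).encard ≤ (Δ + 1 : ℕ) := by
  have hsub : Set.Ici x ⊆ insert x ((comparabilityGraph P).neighborSet x) := by
    intro y hy
    by_cases hxy : x = y
    · exact Or.inl hxy.symm
    · exact Or.inr ⟨hxy, Or.inl hy⟩
  refine (Set.encard_le_encard hsub).trans ((Set.encard_insert_le _ _).trans ?_)
  push_cast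
  gcongr
  exact encard_comparabilityGraph_neighborSet h x

theorem encard_Iic_le {P : Type*} [PartialOrder P] {Δ : ℕ}
    (h : graphMaxDegree (comparabilityGraph P) ≤ Δ) (x : P) :
    (Set.Iic x).encard ≤ (Δ + 1 : ℕ) := by
  have hsub : Set.Iic x ⊆ insert x ((comparabilityGraph P).neighborSet x) := by
    intro y hy
    by_cases hxy : x = y
    · exact Or.inl hxy.symm
    · exact Or.inr ⟨hxy, Or.inr hy⟩
  refine (Set.encard_le_encard hsub).trans ((Set.encard_insert_le _ _).trans ?_)
  push_cast
  gcongr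
  exact encard_comparabilityGraph_neighborSet h x

/-- The dimension bound in terms of free parameters, for arbitrary posets. -/
theorem posetDim_le_of_graphMaxDegree_le {P : Type*} [PartialOrder P]
    (Δ m d r t l h p : ℕ) (hP : graphMaxDegree (comparabilityGraph P) ≤ Δ)
    (hm : 0 < m) (hd : 0 < d) (ht : 0 < t) (hl : 0 < l) (hp : 0 < p)
    (h1 : 4 * ((Δ + 1) * (Δ + 1)) * (Δ + 1).choose (d + 1) ≤ m ^ d)
    (h2 : 4 * (d * (Δ + 1)) * d.choose (r + 1) ^ t ≤ l ^ (r * t))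
    (h3 : 4 * ((Δ + 1) * (Δ + 1)) * (Δ + 1).choose 2 ≤ 2 ^ h) (hr : r ≤ h + 1)
    (h4 : (h + 1).choose r * 2 ^ r * (2 ^ r - 1) ^ p < 2 ^ (r * p)) :
    posetDim P ≤ (m * t * l * p : ℕ) := by
  have hpos : 1 ≤ m * t * l * p := Nat.succ_le_of_lt (by positivity)
  refine iInf₂_le (m * t * l * p) ⟨hpos, exists_isRealizer_of_forall_finset fun T => ?_⟩
  have hcard : ∀ (s : Set P) (u : Set T), Subtype.val '' u ⊆ s → s.encard ≤ (Δ + 1 : ℕ) →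
      u.ncard ≤ Δ + 1 := by
    intro s u hus hs
    rw [← Nat.cast_le (α := ℕ∞), (Set.toFinite u).cast_ncard_eq,
      ← Subtype.val_injective.encard_image u]
    exact (Set.encard_le_encard hus).trans hs
  refine exists_isRealizer_of_finite (Δ + 1) m d r t l h p Δ.succ_pos hm hd hl
    (fun x => hcard _ _ ?_ (encard_Ici_le hP x)) (fun x => hcard _ _ ?_ (encard_Iic_le hP x))
    h1 h2 h3 hr h4
  · rintro _ ⟨y, hy, rfl⟩
    exact hy
  · rintro _ ⟨y, hy, rfl⟩
    exact hy

/-! ### Choice of the parameters -/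

theorem choose_le_exp_mul_div_pow (n k : ℕ) (hk : 0 < k) :
    (n.choose k : ℝ) ≤ (Real.exp 1 * n / k) ^ k := by
  have hk' : (0 : ℝ) < k := by exact_mod_cast hk
  have h1 : (k : ℝ) ^ k / k.factorial ≤ Real.exp 1 ^ k := by
    rw [← Real.exp_nat_mul, mul_one]
    exact Real.pow_div_factorial_le_exp _ hk'.le k
  have h2 : (n.choose k : ℝ) ≤ (n : ℝ) ^ k / k.factorial := Nat.choose_le_pow_div k n
  have hf : (0 : ℝ) < k.factorial := by exact_mod_cast Nat.factorial_pos k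
  rw [div_le_iff₀ hf] at h1
  refine h2.trans ?_
  rw [div_pow, mul_pow, div_le_div_iff₀ hf (by positivity)]
  calc (n : ℝ) ^ k * k ^ k ≤ (n : ℝ) ^ k * (Real.exp 1 ^ k * k.factorial) := by gcongr
    _ = _ := by ring

/-- The union bound for universal families holds as soon as `p > 2^r r log (2 H)`. -/
theorem choose_mul_two_pow_mul_lt (H r p : ℕ) (hH : 0 < H)
    (hp : 2 ^ r * (r * Real.log (2 * H)) < p) :
    H.choose r * 2 ^ r * (2 ^ r - 1) ^ p < 2 ^ (r * p) := by
  have hH' : (0 : ℝ) < H := by exact_mod_cast hH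
  have h2 : (0 : ℝ) < 2 ^ r := by positivity
  have h3 : ((2 ^ r - 1 : ℕ) : ℝ) ≤ 2 ^ r * Real.exp (-(1 / 2 ^ r)) := by
    rw [Nat.cast_sub Nat.one_le_two_pow]
    push_cast
    have := Real.add_one_le_exp (-(1 / 2 ^ r : ℝ))
    calc (2 : ℝ) ^ r - 1 = 2 ^ r * (-(1 / 2 ^ r) + 1) := by field_simp; ring
      _ ≤ _ := by gcongr
  have h4 : ((2 ^ r - 1 : ℕ) : ℝ) ^ p ≤ 2 ^ (r * p) * Real.exp (-(p / 2 ^ r)) := by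
    calc ((2 ^ r - 1 : ℕ) : ℝ) ^ p ≤ (2 ^ r * Real.exp (-(1 / 2 ^ r))) ^ p := by gcongr
      _ = _ := by
        rw [mul_pow, ← pow_mul, ← Real.exp_nat_mul]
        congr 2
        ring
  have h5 : (H.choose r : ℝ) * 2 ^ r ≤ Real.exp (r * Real.log (2 * H)) := by
    rw [Real.exp_nat_mul, Real.exp_log (by positivity), mul_pow, mul_comm]
    gcongr
    exact_mod_cast Nat.choose_le_pow H r
  have h6 : r * Real.log (2 * H) < p / 2 ^ r := by
    rw [lt_div_iff₀ h2]; linarith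
  have h7 : (H.choose r : ℝ) * 2 ^ r * ((2 ^ r - 1 : ℕ) : ℝ) ^ p < 2 ^ (r * p) := by
    calc _ ≤ Real.exp (r * Real.log (2 * H)) * (2 ^ (r * p) * Real.exp (-(p / 2 ^ r))) := by
          gcongr
      _ = 2 ^ (r * p) * Real.exp (r * Real.log (2 * H) - p / 2 ^ r) := by
          rw [sub_eq_add_neg, Real.exp_add]; ring
      _ < 2 ^ (r * p) * 1 := by
          gcongr
          rw [Real.exp_lt_one_iff]
          linarith
      _ = _ := mul_one _
  exact_mod_cast h7

section Parameters

variable {Δ : ℕ} {L : ℝ}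

/-- Classes: the mean number of elements of an up-set in a class is about `L`, and exceeding this by
the factor `8 > e²` has probability at most `exp (-8 L)`. -/
theorem class_condition (hΔ : Real.exp L = Δ) (hL : 100 ≤ L) (hΔL : 100 * L ≤ Δ) :
    4 * ((Δ + 1) * (Δ + 1)) * (Δ + 1).choose (⌈8 * L⌉₊ + 1) ≤ ⌈Δ / L⌉₊ ^ ⌈8 * L⌉₊ := by
  set m := ⌈Δ / L⌉₊ with hm
  set d := ⌈8 * L⌉₊ with hd
  have hL0 : 0 < L := by linarith
  have hm1 : Δ / L ≤ m := Nat.le_ceil _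
  have hm2 : (m : ℝ) ≤ Δ := by
    have h1 : (m : ℝ) < Δ / L + 1 := Nat.ceil_lt_add_one (by positivity)
    have h2 : (Δ : ℝ) / L ≤ Δ / 100 := by gcongr
    linarith
  have hm0 : (0 : ℝ) < m := lt_of_lt_of_le (by have : (0 : ℝ) < Δ := by linarith
                                               positivity) hm1
  have hd1 : 8 * L ≤ d := Nat.le_ceil _
  have he : Real.exp 1 ^ 2 < 7.3892 := by
    have h1 := Real.exp_one_lt_d9
    have h2 := Real.exp_pos 1
    nlinarith
  have hmd : 8 * (Δ : ℝ) ≤ m * (d + 1 : ℕ) := by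
    have : 8 * (Δ : ℝ) = Δ / L * (8 * L) := by field_simp
    rw [this]
    gcongr
    push_cast; linarith
  have hbase : Real.exp 1 * (Δ + 1 : ℕ) / (d + 1 : ℕ) ≤ m * Real.exp (-1) := by
    rw [div_le_iff₀ (by positivity), Real.exp_neg, ← div_eq_mul_inv, div_mul_eq_mul_div,
      le_div_iff₀ (Real.exp_pos 1)]
    calc Real.exp 1 * (Δ + 1 : ℕ) * Real.exp 1 = Real.exp 1 ^ 2 * (Δ + 1) := by push_cast; ring
      _ ≤ 7.3892 * (Δ + 1) := by gcongr
      _ ≤ 8 * Δ := by linarith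
      _ ≤ _ := hmd
  have hC : ((Δ + 1).choose (d + 1) : ℝ) ≤ m ^ (d + 1) * Real.exp (-(8 * L)) := by
    calc _ ≤ (Real.exp 1 * (Δ + 1 : ℕ) / (d + 1 : ℕ)) ^ (d + 1) :=
          choose_le_exp_mul_div_pow _ _ (Nat.succ_pos _)
      _ ≤ (m * Real.exp (-1)) ^ (d + 1) := by gcongr
      _ = m ^ (d + 1) * Real.exp (-(d + 1 : ℕ)) := by
          rw [mul_pow, ← Real.exp_nat_mul]; congr 2; ring
      _ ≤ _ := by
          gcongr
          push_cast; linarith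
  have hsmall : 4 * ((Δ + 1 : ℝ) * (Δ + 1)) * m * Real.exp (-(8 * L)) ≤ 1 := by
    rw [Real.exp_neg, ← div_eq_mul_inv, div_le_one (Real.exp_pos _),
      show 8 * L = (8 : ℕ) * L by norm_num, Real.exp_nat_mul, hΔ]
    have h1 : (100 : ℝ) ≤ Δ := by linarith
    calc 4 * ((Δ + 1 : ℝ) * (Δ + 1)) * m ≤ 4 * ((2 * Δ : ℝ) * (2 * Δ)) * Δ := by
          gcongr <;> linarith
      _ = 16 * (Δ : ℝ) ^ 3 := by ring
      _ ≤ (Δ : ℝ) ^ 5 * (Δ : ℝ) ^ 3 := by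
          gcongr
          calc (16 : ℝ) ≤ 100 ^ 5 := by norm_num
            _ ≤ _ := by gcongr
      _ = _ := by ring
  have hreal : 4 * ((Δ + 1 : ℝ) * (Δ + 1)) * (Δ + 1).choose (d + 1) ≤ m ^ d := by
    calc _ ≤ 4 * ((Δ + 1 : ℝ) * (Δ + 1)) * (m ^ (d + 1) * Real.exp (-(8 * L))) := by gcongr
      _ = m ^ d * (4 * ((Δ + 1 : ℝ) * (Δ + 1)) * m * Real.exp (-(8 * L))) := by ring
      _ ≤ m ^ d * 1 := by gcongr
      _ = _ := mul_one _
  exact_mod_cast hreal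

/-- Colours: with `X = e d / (r + 1)` we have `choose d (r + 1) ≤ X ^ (r + 1)`, so each of the
colourings fails with probability at most `X e^(-s r) ≤ e⁻¹`. -/
theorem colour_condition {s : ℝ} {d r : ℕ} (hΔ : Real.exp L = Δ) (hL : 100 ≤ L)
    (hΔL : 100 * L ≤ Δ) (hd0 : 0 < d) (hd : d ≤ 9 * L) (hs : 70 ≤ s) (hsL : Real.exp (s ^ 2) = L)
    (hr : s ≤ r) :
    4 * (d * (Δ + 1)) * d.choose (r + 1) ^ ⌈2 * L⌉₊ ≤
      ⌈Real.exp 1 * d / (r + 1) * Real.exp s⌉₊ ^ (r * ⌈2 * L⌉₊) := by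
  set t := ⌈2 * L⌉₊ with ht
  set X := Real.exp 1 * d / (r + 1) with hX
  set l := ⌈X * Real.exp s⌉₊ with hl
  have hd0' : (0 : ℝ) < d := by exact_mod_cast hd0
  have hX0 : 0 < X := by positivity
  have he := Real.exp_one_lt_d9
  have he0 := Real.exp_pos 1
  have hXL : Real.exp 1 * X ≤ L := by
    rw [hX, mul_div_assoc', div_le_iff₀ (by positivity)]
    have he2 : Real.exp 1 * Real.exp 1 ≤ 7.5 := by nlinarith
    calc Real.exp 1 * (Real.exp 1 * d) = Real.exp 1 * Real.exp 1 * d := by ring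
      _ ≤ 7.5 * (9 * L) := by gcongr
      _ ≤ L * (r + 1) := by nlinarith
  have hC : Real.exp 1 * d.choose (r + 1) ≤ (l : ℝ) ^ r := by
    have h1 : (d.choose (r + 1) : ℝ) ≤ X ^ (r + 1) := by
      have := choose_le_exp_mul_div_pow d (r + 1) (Nat.succ_pos _)
      push_cast at this
      exact this
    have h2 : L ≤ Real.exp s ^ r := by
      rw [← Real.exp_nat_mul, ← hsL]
      gcongr
      nlinarith
    calc Real.exp 1 * d.choose (r + 1) ≤ Real.exp 1 * X ^ (r + 1) := by gcongr
      _ = X ^ r * (Real.exp 1 * X) := by ring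
      _ ≤ X ^ r * Real.exp s ^ r := by gcongr; exact hXL.trans h2
      _ = (X * Real.exp s) ^ r := by rw [mul_pow]
      _ ≤ _ := by gcongr; exact Nat.le_ceil _
  have ht1 : 4 * ((d : ℝ) * (Δ + 1)) ≤ Real.exp 1 ^ t := by
    calc 4 * ((d : ℝ) * (Δ + 1)) ≤ 4 * (9 * L * (2 * Δ)) := by gcongr; linarith
      _ = (72 * L) * Δ := by ring
      _ ≤ Δ * Δ := by gcongr; linarith
      _ = Real.exp (2 * L) := by rw [two_mul, Real.exp_add, hΔ]
      _ ≤ Real.exp t := by gcongr; exact Nat.le_ceil _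
      _ = _ := by rw [← Real.exp_nat_mul, mul_one]
  have hreal : 4 * ((d : ℝ) * (Δ + 1)) * (d.choose (r + 1) : ℝ) ^ t ≤ (l : ℝ) ^ (r * t) := by
    calc _ ≤ Real.exp 1 ^ t * (d.choose (r + 1) : ℝ) ^ t := by gcongr
      _ = (Real.exp 1 * d.choose (r + 1)) ^ t := by rw [mul_pow]
      _ ≤ ((l : ℝ) ^ r) ^ t := by gcongr
      _ = _ := by rw [pow_mul]
  exact_mod_cast hreal

theorem palette_condition (hΔ : Real.exp L = Δ) (hL : 100 ≤ L) (hΔL : 100 * L ≤ Δ) :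
    4 * ((Δ + 1) * (Δ + 1)) * (Δ + 1).choose 2 ≤ 2 ^ ⌈10 * L⌉₊ := by
  have hΔ1 : (100 : ℝ) ≤ Δ := by linarith
  have h1 : ((Δ + 1).choose 2 : ℝ) ≤ (Δ + 1) ^ 2 := by
    exact_mod_cast Nat.choose_le_pow (Δ + 1) 2
  have h2 : Real.exp (5 * L) ≤ 2 ^ ⌈10 * L⌉₊ := by
    have h3 : (2 : ℝ) ^ ⌈10 * L⌉₊ = Real.exp (⌈10 * L⌉₊ * Real.log 2) := by
      rw [Real.exp_nat_mul, Real.exp_log two_pos]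
    rw [h3, Real.exp_le_exp]
    have h4 : 10 * L ≤ ⌈10 * L⌉₊ := Nat.le_ceil _
    have h5 := Real.log_two_gt_d9
    nlinarith
  have hreal : 4 * ((Δ + 1 : ℝ) * (Δ + 1)) * (Δ + 1).choose 2 ≤ 2 ^ ⌈10 * L⌉₊ := by
    calc _ ≤ 4 * ((2 * Δ : ℝ) * (2 * Δ)) * (2 * Δ) ^ 2 := by
          refine mul_le_mul ?_ (h1.trans ?_) (by positivity) (by positivity)
          · gcongr <;> linarith
          · gcongr; linarith
      _ = 64 * (Δ : ℝ) ^ 4 := by ring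
      _ ≤ Δ * (Δ : ℝ) ^ 4 := by gcongr; linarith
      _ = Real.exp (5 * L) := by
          rw [show 5 * L = (5 : ℕ) * L by norm_num, Real.exp_nat_mul, hΔ]; ring
      _ ≤ _ := h2
  exact_mod_cast hreal

/-- The product of the parameters, with the factors `1 / r` of the number of colours and `r` of the
number of flips cancelling. -/
theorem parameter_product_le {s Δ' m t l p d H r : ℝ} (hL : 100 ≤ L) (hΔL : 100 * L ≤ Δ')
    (hs : 70 ≤ s) (hsL : Real.exp (s ^ 2) = L) (hr : s ≤ r) (hr' : r ≤ s + 1)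
    (hm : m ≤ Δ' / L + 1) (ht0 : 0 ≤ t) (ht : t ≤ 2 * L + 1) (hl0 : 0 ≤ l)
    (hl : l ≤ Real.exp 1 * d / (r + 1) * Real.exp s + 1) (hd0 : 0 ≤ d) (hd : d ≤ 8 * L + 1)
    (hp0 : 0 ≤ p) (hp : p ≤ 2 ^ r * (r * Real.log (2 * H)) + 1) (hH0 : 1 ≤ H)
    (hH : H ≤ 10 * L + 2) :
    m * t * l * p ≤ 360 * Δ' * L * (2 * Real.exp 1) ^ s * s ^ 2 := by
  have hL0 : 0 < L := by linarith
  have hr0 : 0 < r := by linarith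
  have he := Real.exp_one_lt_d9
  have hes : 1 ≤ Real.exp s := Real.one_le_exp (by linarith)
  have h2s : (1 : ℝ) ≤ 2 ^ s := Real.one_le_rpow one_le_two (by linarith)
  have hm' : m ≤ 1.2 * Δ' / L := by
    have : (1 : ℝ) ≤ 0.2 * Δ' / L := by
      rw [le_div_iff₀ hL0]; linarith
    calc m ≤ Δ' / L + 1 := hm
      _ ≤ Δ' / L + 0.2 * Δ' / L := by gcongr
      _ = _ := by ring
  have ht' : t ≤ 2.2 * L := by linarith
  have hrL : r ≤ 0.5 * (L * Real.exp s) := by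
    have h1 : s ^ 2 + 1 ≤ L := hsL ▸ Real.add_one_le_exp (s ^ 2)
    nlinarith
  have hl' : l * r ≤ 23 * (L * Real.exp s) := by
    have h1 : Real.exp 1 * d / (r + 1) * r ≤ 22.4 * L := by
      rw [div_mul_eq_mul_div, div_le_iff₀ (by positivity)]
      calc Real.exp 1 * d * r ≤ 2.72 * (8.2 * L) * (r + 1) := by
            gcongr <;> linarith
        _ ≤ 22.4 * L * (r + 1) := by
            gcongr ?_ * (r + 1)
            linarith
    calc l * r ≤ (Real.exp 1 * d / (r + 1) * Real.exp s + 1) * r := by gcongr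
      _ = Real.exp 1 * d / (r + 1) * r * Real.exp s + r := by ring
      _ ≤ 22.4 * L * Real.exp s + 0.5 * (L * Real.exp s) := by gcongr
      _ ≤ _ := by nlinarith [mul_pos hL0 (Real.exp_pos s)]
  have hlog : Real.log (2 * H) ≤ 1.2 * s ^ 2 := by
    rw [Real.log_le_iff_le_exp (by positivity)]
    calc 2 * H ≤ L * 24 := by linarith
      _ ≤ L * Real.exp (0.2 * s ^ 2) := by
          gcongr
          have := Real.add_one_le_exp (0.2 * s ^ 2)
          nlinarith
      _ = _ := by rw [← hsL, ← Real.exp_add]; congr 1; ring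
  have hlog0 : 0 ≤ Real.log (2 * H) := Real.log_nonneg (by linarith)
  have h2r : (2 : ℝ) ^ r ≤ 2 * 2 ^ s := by
    calc (2 : ℝ) ^ r ≤ 2 ^ (s + 1) := Real.rpow_le_rpow_of_exponent_le one_le_two hr'
      _ = _ := by rw [Real.rpow_add two_pos, Real.rpow_one, mul_comm]
  have hp' : p ≤ r * (2.5 * (2 ^ s * s ^ 2)) := by
    have h1 : 1 ≤ r * (0.1 * (2 ^ s * s ^ 2)) := by
      have h3 : 1 ≤ (2 : ℝ) ^ s * s ^ 2 := one_le_mul_of_one_le_of_one_le h2s (by nlinarith)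
      nlinarith
    calc p ≤ 2 ^ r * (r * Real.log (2 * H)) + 1 := hp
      _ ≤ 2 * 2 ^ s * (r * (1.2 * s ^ 2)) + r * (0.1 * (2 ^ s * s ^ 2)) := by gcongr
      _ = _ := by ring
  have hpow : (2 * Real.exp 1) ^ s = 2 ^ s * Real.exp s := by
    rw [Real.mul_rpow two_pos.le (Real.exp_pos 1).le, Real.exp_one_rpow]
  have hΔ0 : 0 < Δ' := by nlinarith
  calc m * t * l * p ≤ (1.2 * Δ' / L) * (2.2 * L) * l * (r * (2.5 * (2 ^ s * s ^ 2))) := by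
        gcongr
    _ = (1.2 * Δ' / L) * (2.2 * L) * (l * r) * (2.5 * (2 ^ s * s ^ 2)) := by ring
    _ ≤ (1.2 * Δ' / L) * (2.2 * L) * (23 * (L * Real.exp s)) * (2.5 * (2 ^ s * s ^ 2)) := by
        gcongr
    _ = 151.8 * (Δ' * L * (2 ^ s * Real.exp s) * s ^ 2) := by field_simp; ring
    _ ≤ 360 * (Δ' * L * (2 ^ s * Real.exp s) * s ^ 2) := by
        gcongr; norm_num
    _ = _ := by rw [hpow]; ring

end Parameters

/-- The dimension bound for every `Δ` with `√(log log Δ) ≥ 70`. -/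
theorem posetDim_le_of_le_sqrt_log_log {P : Type*} [PartialOrder P] (Δ : ℕ)
    (hP : graphMaxDegree (comparabilityGraph P) ≤ Δ)
    (hs : 70 ≤ Real.sqrt (Real.log (Real.log Δ))) :
    ∃ N : ℕ, posetDim P ≤ N ∧ (N : ℝ) ≤ 360 * Δ * Real.log Δ *
      (2 * Real.exp 1) ^ Real.sqrt (Real.log (Real.log Δ)) * Real.log (Real.log Δ) := by
  set L := Real.log Δ with hLdef
  set s := Real.sqrt (Real.log L) with hsdef
  have hM0 : 0 < Real.log L := Real.sqrt_pos.1 (by linarith)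
  have hM : s ^ 2 = Real.log L := Real.sq_sqrt hM0.le
  have hL0 : 0 ≤ L := Real.log_natCast_nonneg Δ
  have hLpos : 0 < L := hL0.lt_of_ne fun h => by simp [← h] at hM0
  have hsL : Real.exp (s ^ 2) = L := by rw [hM, Real.exp_log hLpos]
  have hsL' : s ^ 2 + 1 ≤ L := hsL ▸ Real.add_one_le_exp (s ^ 2)
  have hL : 4900 ≤ L := by nlinarith
  have hΔ0 : Δ ≠ 0 := by
    rintro rfl
    simp at hLdef
    linarith
  have hΔ : Real.exp L = Δ := Real.exp_log (by positivity)
  have hΔL : 100 * L ≤ Δ := by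
    have := Real.quadratic_le_exp_of_nonneg hL0
    rw [hΔ] at this
    nlinarith
  obtain ⟨r, hr1, hr2⟩ : ∃ r : ℕ, s ≤ r ∧ (r : ℝ) ≤ s + 1 :=
    ⟨⌈s⌉₊, Nat.le_ceil _, (Nat.ceil_lt_add_one (by linarith)).le⟩
  have hd1 : 8 * L ≤ ⌈8 * L⌉₊ := Nat.le_ceil _
  have hd2 : (⌈8 * L⌉₊ : ℝ) ≤ 8 * L + 1 := (Nat.ceil_lt_add_one (by linarith)).le
  have hd0 : 0 < ⌈8 * L⌉₊ := Nat.ceil_pos.2 (by linarith)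
  have hh1 : 10 * L ≤ ⌈10 * L⌉₊ := Nat.le_ceil _
  have hh2 : (⌈10 * L⌉₊ : ℝ) ≤ 10 * L + 1 := (Nat.ceil_lt_add_one (by linarith)).le
  have hΔ' : (0 : ℝ) < Δ := by positivity
  have hd0' : (0 : ℝ) < ⌈8 * L⌉₊ := by exact_mod_cast hd0
  have hlog : 0 ≤ Real.log (2 * (⌈10 * L⌉₊ + 1 : ℕ)) :=
    Real.log_nonneg (by push_cast; linarith)
  refine ⟨⌈Δ / L⌉₊ * ⌈2 * L⌉₊ * ⌈Real.exp 1 * ⌈8 * L⌉₊ / (r + 1) * Real.exp s⌉₊ *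
    (⌊2 ^ r * (r * Real.log (2 * (⌈10 * L⌉₊ + 1 : ℕ)))⌋₊ + 1),
    posetDim_le_of_graphMaxDegree_le Δ _ ⌈8 * L⌉₊ r _ _ ⌈10 * L⌉₊ _ hP
      (Nat.ceil_pos.2 (by positivity)) hd0 (Nat.ceil_pos.2 (by positivity))
      (Nat.ceil_pos.2 (by positivity)) (Nat.succ_pos _)
      (class_condition hΔ (by linarith) hΔL)
      (colour_condition hΔ (by linarith) hΔL hd0 (by linarith) hs hsL hr1)
      (palette_condition hΔ (by linarith) hΔL) ?_
      (choose_mul_two_pow_mul_lt _ _ _ (Nat.succ_pos _) ?_), ?_⟩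
  · have h1 : (r : ℝ) ≤ (⌈10 * L⌉₊ + 1 : ℕ) := by push_cast; nlinarith
    exact_mod_cast h1
  · push_cast
    exact Nat.lt_floor_add_one _
  · rw [← hM]
    push_cast
    refine parameter_product_le (d := ⌈8 * L⌉₊) (r := r) (H := (⌈10 * L⌉₊ + 1 : ℕ)) (by linarith)
      hΔL hs hsL hr1 hr2 (Nat.ceil_lt_add_one (by positivity)).le (by positivity)
      (Nat.ceil_lt_add_one (by positivity)).le (by positivity)
      (Nat.ceil_lt_add_one (by positivity)).le (by positivity) hd2 (by positivity) ?_
      (by push_cast; linarith) (by push_cast; linarith)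
    rw [Real.rpow_natCast]
    gcongr
    push_cast at hlog ⊢
    exact Nat.floor_le (by positivity)

theorem theorem3p6 :
    ∃ ε : ℕ → ℝ, Tendsto ε atTop (𝓝 0) ∧
      ∀ᶠ Δ : ℕ in atTop, ∀ (P : Type*) [PartialOrder P],
        graphMaxDegree (comparabilityGraph P) = (Δ : ℕ∞) →
          ∃ d : ℕ, posetDim P = (d : ℕ∞) ∧
            (d : ℝ) ≤ (360 + ε Δ) * (Δ : ℝ) * Real.log Δ *
              (2 * Real.exp 1) ^ Real.sqrt (Real.log (Real.log Δ)) *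
                Real.log (Real.log Δ) := by
  -- The product of the chosen parameters is below `152 Δ ⋯` already, so no error term is needed.
  refine ⟨fun _ => 0, tendsto_const_nhds, ?_⟩
  have hlim : Tendsto (fun Δ : ℕ => Real.sqrt (Real.log (Real.log Δ))) atTop atTop :=
    Real.tendsto_sqrt_atTop.comp (Real.tendsto_log_atTop.comp
      (Real.tendsto_log_atTop.comp tendsto_natCast_atTop_atTop))
  filter_upwards [hlim.eventually_ge_atTop 70] with Δ hs P _ hP
  obtain ⟨N, hN, hN'⟩ := posetDim_le_of_le_sqrt_log_log Δ hP.le hs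
  obtain ⟨d, hd⟩ := ENat.ne_top_iff_exists.1 (ne_top_of_le_ne_top (ENat.natCast_ne_top N) hN)
  refine ⟨d, hd.symm, ?_⟩
  rw [← hd, Nat.cast_le] at hN
  rw [add_zero]
  exact (Nat.cast_le.2 hN).trans hN'
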